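/- Let $k\ge 3$ and let $\mathfrak m_{0,1}(2k+1)$ be the real Lie algebra with basis $X_1,\dots,X_{2k+1}$ whose nonzero brackets of basis vectors are, up to skew-symmetry, $[X_1,X_i]=X_{i+1}$ for $i=2,\dots,2k$ and $[X_l,X_{2k+1-l}]=(-1)^{l+1}X_{2k+1}$ for $l=2,\dots,k$. Given an inner product $\langle\cdot,\cdot\rangle$ on a real Lie algebra $\mathfrak g$, a Lie subalgebra $\mathfrak h\subseteq\mathfrak g$ is called totally geodesic if $\langle[X,Y],Z\rangle+\langle[X,Z],Y\rangle=0$ for all $X\in\mathfrak h^{\perp}$ and all $Y,Z\in\mathfrak h$. Then the minimal codimension of a proper subalgebra of $\mathfrak m_{0,1}(2k+1)$ that is totally geodesic with respect to some inner product is exactly four: for every inner product on $\mathfrak m_{0,1}(2k+1)$, every proper totally geodesic subalgebra has codimension at least $4$, and there are an inner product on $\mathfrak m_{0,1}(2k+1)$ and a totally geodesic subalgebra of codimension exactly $4$. -/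

import Mathlib

/-- The underlying real vector space of the Lie algebra `m_{0,1}(2k+1)`: coordinate vectors of
length `2k+1` with respect to the basis `X_1, …, X_{2k+1}`. -/
def M01 (k : ℕ) : Type := Fin (2 * k + 1) → ℝ

namespace M01

instance (k : ℕ) : AddCommGroup (M01 k) := inferInstanceAs (AddCommGroup (Fin (2 * k + 1) → ℝ))

instance (k : ℕ) : Module ℝ (M01 k) := inferInstanceAs (Module ℝ (Fin (2 * k + 1) → ℝ))

/-- The coefficient of `X_i` in `x`, for `1 ≤ i ≤ 2k+1` (and `0` for all other `i`). -/
def coeff {k : ℕ} (x : M01 k) (i : ℕ) : ℝ :=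
  if h : 1 ≤ i ∧ i ≤ 2 * k + 1 then x ⟨i - 1, by omega⟩ else 0

/-- The vector with prescribed coefficients `f i` of `X_i`, `1 ≤ i ≤ 2k+1`. -/
def ofCoeff (k : ℕ) (f : ℕ → ℝ) : M01 k := fun i => f (i + 1)

/-- The basis vector `X_i`, for `1 ≤ i ≤ 2k+1` (and `0` for all other `i`). -/
def X (k i : ℕ) : M01 k := ofCoeff k (fun j => if j = i then 1 else 0)

theorem coeff_ofCoeff (k : ℕ) (f : ℕ → ℝ) (i : ℕ) :
    (ofCoeff k f).coeff i = if 1 ≤ i ∧ i ≤ 2 * k + 1 then f i else 0 := by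
  unfold coeff ofCoeff
  by_cases h : 1 ≤ i ∧ i ≤ 2 * k + 1
  · simp only [h, and_self, dite_true, if_true]
    congr 1
    omega
  · simp [h]

theorem ext_coeff {k : ℕ} {x y : M01 k} (h : ∀ i, 1 ≤ i → i ≤ 2 * k + 1 → x.coeff i = y.coeff i) :
    x = y := by
  funext i
  have h' := h (i + 1) (by omega) (by omega)
  have hi : 1 ≤ (i : ℕ) + 1 ∧ (i : ℕ) + 1 ≤ 2 * k + 1 := by omega
  unfold coeff at h'
  simpa [hi] using h'

theorem coeff_add {k : ℕ} (x y : M01 k) (i : ℕ) : (x + y).coeff i = x.coeff i + y.coeff i := by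
  unfold coeff
  split_ifs
  · rfl
  · simp

theorem coeff_smul {k : ℕ} (c : ℝ) (x : M01 k) (i : ℕ) : (c • x).coeff i = c * x.coeff i := by
  unfold coeff
  split_ifs
  · rfl
  · simp

theorem coeff_zero {k : ℕ} (i : ℕ) : (0 : M01 k).coeff i = 0 := by
  unfold coeff
  split_ifs <;> rfl

/-- The skew-symmetric form `ω` with `ω(X_l, X_{2k+1-l}) = (-1)^(l+1)` for `l = 2, …, k`. -/
def form {k : ℕ} (x y : M01 k) : ℝ :=
  ∑ l ∈ Finset.Icc 2 k, (-1 : ℝ) ^ (l + 1) *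
    (x.coeff l * y.coeff (2 * k + 1 - l) - y.coeff l * x.coeff (2 * k + 1 - l))

/-- The bilinear skew-symmetric bracket determined by `[X_1, X_i] = X_{i+1}` for `2 ≤ i ≤ 2k` and
`[X_l, X_{2k+1-l}] = (-1)^(l+1) X_{2k+1}` for `2 ≤ l ≤ k`, all the other brackets `[X_i, X_j]`
with `i < j` being zero. -/
def bracket {k : ℕ} (x y : M01 k) : M01 k :=
  ofCoeff k fun m =>
    (if 3 ≤ m then x.coeff 1 * y.coeff (m - 1) - y.coeff 1 * x.coeff (m - 1) else 0) +
      (if m = 2 * k + 1 then form x y else 0)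

instance (k : ℕ) : Bracket (M01 k) (M01 k) := ⟨bracket⟩

theorem coeff_lie {k : ℕ} (x y : M01 k) (m : ℕ) :
    (⁅x, y⁆ : M01 k).coeff m = if 1 ≤ m ∧ m ≤ 2 * k + 1 then
      (if 3 ≤ m then x.coeff 1 * y.coeff (m - 1) - y.coeff 1 * x.coeff (m - 1) else 0) +
        (if m = 2 * k + 1 then form x y else 0) else 0 := by
  change (bracket x y).coeff m = _
  unfold bracket
  rw [coeff_ofCoeff]

theorem form_skew {k : ℕ} (x y : M01 k) : form x y = -form y x := by
  unfold form
  rw [← Finset.sum_neg_distrib]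
  exact Finset.sum_congr rfl fun l _ => by ring

theorem form_add_right {k : ℕ} (x y z : M01 k) : form x (y + z) = form x y + form x z := by
  unfold form
  rw [← Finset.sum_add_distrib]
  exact Finset.sum_congr rfl fun l _ => by rw [coeff_add, coeff_add]; ring

theorem form_smul_right {k : ℕ} (c : ℝ) (x y : M01 k) : form x (c • y) = c * form x y := by
  unfold form
  rw [Finset.mul_sum]
  exact Finset.sum_congr rfl fun l _ => by rw [coeff_smul, coeff_smul]; ring

/-- `s x z = ω(x, N z)`, where `N` is the operator `ad X_1`. -/
def s {k : ℕ} (x z : M01 k) : ℝ :=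
  ∑ l ∈ Finset.Icc 2 k, (-1 : ℝ) ^ (l + 1) *
    (x.coeff l * z.coeff (2 * k - l) -
      (if 3 ≤ l then z.coeff (l - 1) else 0) * x.coeff (2 * k + 1 - l))

theorem form_lie {k : ℕ} (x y z : M01 k) :
    form x ⁅y, z⁆ = y.coeff 1 * s x z - z.coeff 1 * s x y := by
  unfold form s
  rw [Finset.mul_sum, Finset.mul_sum, ← Finset.sum_sub_distrib]
  refine Finset.sum_congr rfl fun l hl => ?_
  have hl' := Finset.mem_Icc.1 hl
  have e1 : (⁅y, z⁆ : M01 k).coeff l =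
      if 3 ≤ l then y.coeff 1 * z.coeff (l - 1) - z.coeff 1 * y.coeff (l - 1) else 0 := by
    rw [coeff_lie, if_pos (by omega), if_neg (by omega : ¬ l = 2 * k + 1), add_zero]
  have e2 : (⁅y, z⁆ : M01 k).coeff (2 * k + 1 - l) =
      y.coeff 1 * z.coeff (2 * k - l) - z.coeff 1 * y.coeff (2 * k - l) := by
    rw [coeff_lie, if_pos (by omega), if_pos (by omega : 3 ≤ 2 * k + 1 - l),
      if_neg (by omega : ¬ 2 * k + 1 - l = 2 * k + 1), add_zero,
      show 2 * k + 1 - l - 1 = 2 * k - l by omega]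
  rw [e1, e2]
  split_ifs <;> ring

theorem s_eq {k : ℕ} (hk : 2 ≤ k) (x z : M01 k) :
    s x z = (-1 : ℝ) ^ (k + 1) * (x.coeff k * z.coeff k) +
      ∑ l ∈ Finset.Ico 2 k, (-1 : ℝ) ^ (l + 1) *
        (x.coeff l * z.coeff (2 * k - l) + z.coeff l * x.coeff (2 * k - l)) := by
  unfold s
  simp only [mul_sub, mul_add, Finset.sum_sub_distrib, Finset.sum_add_distrib]
  have h1 : ∑ l ∈ Finset.Icc 2 k, (-1 : ℝ) ^ (l + 1) * (x.coeff l * z.coeff (2 * k - l)) =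
      ∑ l ∈ Finset.Ico 2 k, (-1 : ℝ) ^ (l + 1) * (x.coeff l * z.coeff (2 * k - l)) +
        (-1 : ℝ) ^ (k + 1) * (x.coeff k * z.coeff k) := by
    rw [← Finset.Ico_add_one_right_eq_Icc, Finset.sum_Ico_succ_top hk,
      show 2 * k - k = k by omega]
  have h2 : ∑ l ∈ Finset.Icc 2 k, (-1 : ℝ) ^ (l + 1) *
      ((if 3 ≤ l then z.coeff (l - 1) else 0) * x.coeff (2 * k + 1 - l)) =
      -∑ l ∈ Finset.Ico 2 k, (-1 : ℝ) ^ (l + 1) * (z.coeff l * x.coeff (2 * k - l)) := by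
    rw [← Finset.Ico_add_one_right_eq_Icc, Finset.sum_eq_sum_Ico_succ_bot (by omega),
      ← Finset.sum_Ico_add' _ 2 k 1, ← Finset.sum_neg_distrib]
    simp only [show ¬ (3 ≤ 2) by omega, if_false, zero_mul, mul_zero, zero_add]
    refine Finset.sum_congr rfl fun l hl => ?_
    have hl' := Finset.mem_Ico.1 hl
    rw [if_pos (by omega), show 2 * k + 1 - (l + 1) = 2 * k - l by omega,
      show l + 1 - 1 = l by omega]
    ring
  rw [h1, h2]
  ring

theorem s_symm {k : ℕ} (x z : M01 k) : s x z = s z x := by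
  by_cases hk : 2 ≤ k
  · rw [s_eq hk, s_eq hk, mul_comm (x.coeff k)]
    congr 1
    exact Finset.sum_congr rfl fun l _ => by ring
  · unfold s
    rw [Finset.Icc_eq_empty (by omega)]
    simp

theorem form_self {k : ℕ} (x : M01 k) : form x x = 0 := by
  have := form_skew x x
  linarith

theorem lie_skew' {k : ℕ} (x y : M01 k) : (⁅x, y⁆ : M01 k) = -⁅y, x⁆ := by
  have h : (⁅x, y⁆ : M01 k) = (-1 : ℝ) • (⁅y, x⁆ : M01 k) := by
    refine ext_coeff fun m h1 h2 => ?_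
    rw [coeff_smul, coeff_lie, coeff_lie, form_skew y x]
    split_ifs <;> ring
  rw [h, neg_one_smul]

theorem lie_add' {k : ℕ} (x y z : M01 k) : (⁅x, y + z⁆ : M01 k) = ⁅x, y⁆ + ⁅x, z⁆ := by
  refine ext_coeff fun m h1 h2 => ?_
  simp only [coeff_add, coeff_lie, form_add_right]
  split_ifs <;> ring

theorem leibniz' {k : ℕ} (x y z : M01 k) :
    (⁅x, ⁅y, z⁆⁆ : M01 k) = ⁅⁅x, y⁆, z⁆ + ⁅y, ⁅x, z⁆⁆ := by
  refine ext_coeff fun m h1 h2 => ?_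
  rw [coeff_add, lie_skew' ⁅x, y⁆ z, ← neg_one_smul ℝ, coeff_smul]
  rw [coeff_lie x ⁅y, z⁆, coeff_lie z ⁅x, y⁆, coeff_lie y ⁅x, z⁆]
  rw [form_lie, form_lie, form_lie, s_symm z y, s_symm z x, s_symm y x]
  simp only [coeff_lie, show ¬ (3 ≤ 1) by omega]
  have hm : m - 1 ≠ 2 * k + 1 := by omega
  rcases Nat.eq_zero_or_pos k with hk | hk
  · subst hk
    have hm1 : m = 1 := by omega
    subst hm1
    simp [s]
  · have h10 : (1 : ℕ) ≠ 2 * k + 1 := by omega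
    simp only [hm, h10, if_false, add_zero, ite_self]
    split_ifs <;> ring

instance (k : ℕ) : LieRing (M01 k) where
  add_lie x y z := by
    rw [lie_skew', lie_add', lie_skew' z x, lie_skew' z y]
    abel
  lie_add := lie_add'
  lie_self x := by
    refine ext_coeff fun m h1 h2 => ?_
    rw [coeff_lie, form_self, coeff_zero]
    split_ifs <;> ring
  leibniz_lie := leibniz'

instance (k : ℕ) : LieAlgebra ℝ (M01 k) where
  lie_smul c x y := by
    refine ext_coeff fun m h1 h2 => ?_
    simp only [coeff_smul, coeff_lie, form_smul_right]
    split_ifs <;> ring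

theorem coeff_X (k i j : ℕ) : (X k i).coeff j = if 1 ≤ j ∧ j ≤ 2 * k + 1 ∧ j = i then 1 else 0 := by
  unfold X; rw [coeff_ofCoeff]; split_ifs <;> first | rfl | (exfalso; omega)

/-- The relations `[X_1, X_i] = X_{i+1}` for `2 ≤ i ≤ 2k`. -/
theorem lie_X_one (k i : ℕ) (h : 2 ≤ i) (h' : i ≤ 2*k) : ⁅X k 1, X k i⁆ = X k (i+1) := by
  refine ext_coeff fun m h1 h2 => ?_
  rw [coeff_lie]
  have : form (X k 1) (X k i) = 0 := by
    unfold form; apply Finset.sum_eq_zero; intro l hl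
    have := Finset.mem_Icc.1 hl
    simp only [coeff_X]
    rw [if_neg (by omega), if_neg (by omega : ¬ (1 ≤ 2*k+1-l ∧ _ ∧ 2*k+1-l = 1))]; ring
  rw [this]; simp only [coeff_X]
  grind

/-- The relations `[X_i, X_j]` for `2 ≤ i ≤ j ≤ 2k+1`. -/
theorem lie_X_X (k i j : ℕ) (h : 2 ≤ i) (h' : i ≤ j) :
    ⁅X k i, X k j⁆ = if i + j = 2*k+1 then (-1:ℝ)^(i+1) • X k (2*k+1) else 0 := by
  refine ext_coeff fun m h1 h2 => ?_
  rw [coeff_lie]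
  have : form (X k i) (X k j) = if i + j = 2*k+1 then (-1:ℝ)^(i+1) else 0 := by
    unfold form; split_ifs with hh
    · rw [Finset.sum_eq_single i]
      · simp only [coeff_X]; rw [if_pos (by simp; omega : 1 ≤ i ∧ i ≤ 2*k+1 ∧ True), if_pos (by omega : 1 ≤ 2*k+1-i ∧ _ ∧ 2*k+1-i = j), if_neg (by omega : ¬ (1 ≤ i ∧ _ ∧ i = j))]; ring
      · intro l hl hne
        have := Finset.mem_Icc.1 hl
        simp only [coeff_X]
        rw [if_neg (by omega), if_neg (by omega : ¬ (1 ≤ l ∧ _ ∧ l = j))]; ring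
      · intro hn; exfalso; apply hn; simp; omega
    · apply Finset.sum_eq_zero; intro l hl
      have := Finset.mem_Icc.1 hl
      simp only [coeff_X]
      grind
  rw [this]
  have e : (X k i).coeff 1 = 0 := by rw [coeff_X, if_neg (by omega)]
  have e' : (X k j).coeff 1 = 0 := by rw [coeff_X, if_neg (by omega)]
  rw [e,e']
  simp only [zero_mul, sub_self, ite_self, zero_add, if_pos (And.intro h1 h2)]
  split_ifs with c1 c2 c2 <;> (try rw [coeff_smul, coeff_X]) <;> (try rw [coeff_zero])
  · rw [if_pos (by omega)]; ring
  · rw [if_neg (by omega)]; ring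

end M01

/-- A subalgebra `h` of a real Lie algebra `g` with an inner product `I` is totally geodesic if
`⟨[X, Y], Z⟩ + ⟨[X, Z], Y⟩ = 0` for all `X` in the orthogonal complement of `h` and all
`Y, Z` in `h`. -/
def IsTotallyGeodesic {g : Type*} [LieRing g] [LieAlgebra ℝ g]
    (I : InnerProductSpace.Core ℝ g) (h : LieSubalgebra ℝ g) : Prop :=
  ∀ X : g, (∀ W ∈ h, I.inner X W = 0) →
    ∀ Y ∈ h, ∀ Z ∈ h, I.inner ⁅X, Y⁆ Z + I.inner ⁅X, Z⁆ Y = 0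

/-!
Write `z = X_{2k+1}`, `r = X_{2k}`, and let `V = ⟨X_2, …, X_{2k+1}⟩` be the ideal of vectors with
vanishing `X_1`-coefficient. On `V` the bracket is `⁅x, y⁆ = form x y • z`, and the radical of
`form` on `V` is `⟨r, z⟩`.

**Lower bound.** Let `h` be proper and totally geodesic of codimension at most three. If `h` is not
contained in `V`, then `h ∩ V` is stable under a regular nilpotent operator and, being large, contains
`X_{2k-1}`, `r` and `z` (`M01.mem_of_leading_coeff`). Testing the skew-symmetry against `z` shows
that `h^⊥` has no `X_1`- and then no `X_2`-coefficients, so `h` contains a vector of `V` with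
nonzero `X_2`-coefficient and is everything (`M01.coeff_one_eq_zero_of_isTotallyGeodesic`).
If `h ⊆ V`, a dimension count for isotropic subspaces gives `z ∈ h`
(`M01.X_last_mem_of_finrank`); testing against `z` shows that `h` and `h^⊥ ∩ V` are
`form`-orthogonal. As `h^⊥ ∩ V` has dimension at most two, it must be a line spanned by
`r - β z`, because a complementary vector would lie in the radical. Modulo this line and `z`, a
vector of `h^⊥` with `X_1`-coefficient one acts on `h` as the nilpotent `ad X_1`, and this cannot be
skew-symmetric (`M01.not_isTotallyGeodesic_of_coeff_one_eq_zero`).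

**Example of codimension four.** Put `K = k - 2`. In the symplectic space
`⟨X_2, …, X_{2k-1}⟩` choose the plane spanned by `X_2` and a vector `v` whose coefficients are those
of a power series `C`, and let `P` be the `form`-complement of that plane. The subalgebra is
`P ⊕ ⟨z⟩`, with orthogonal complement `⟨X_1, X_2, v, r⟩`. Only `X_1` acts on it nontrivially, and
the characteristic polynomial of its compression to `P` is governed by `C²` up to order `K`. Taking
for `C` the square root of `∏ (1 + λ_i² t)` makes the eigenvalues `± i λ_i`, all distinct, so that
the compression is skew-symmetric for a suitable inner product. The real eigenplanes are spanned by
the explicit vectors `M01.oddVec` and `M01.evenVec`, whose coefficients are those of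
`C(t) / (1 + λ_i² t)` (`M01.lie_X_one_oddVec`, `M01.lie_X_one_evenVec`).
-/

/-! ### Coordinates, the form and brackets -/

namespace M01

variable {k : ℕ}

instance (k : ℕ) : Module.Finite ℝ (M01 k) :=
  inferInstanceAs (Module.Finite ℝ (Fin (2 * k + 1) → ℝ))

theorem finrank_eq (k : ℕ) : Module.finrank ℝ (M01 k) = 2 * k + 1 :=
  (Module.finrank_fin_fun ℝ : Module.finrank ℝ (Fin (2 * k + 1) → ℝ) = 2 * k + 1)

/-- The coefficient of `X_i` as a linear functional. -/
def coeffₗ (k i : ℕ) : M01 k →ₗ[ℝ] ℝ where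
  toFun x := x.coeff i
  map_add' x y := coeff_add x y i
  map_smul' c x := coeff_smul c x i

@[simp] theorem coeffₗ_apply (i : ℕ) (x : M01 k) : coeffₗ k i x = x.coeff i := rfl

theorem coeff_sub (x y : M01 k) (i : ℕ) : (x - y).coeff i = x.coeff i - y.coeff i :=
  map_sub (coeffₗ k i) x y

theorem coeff_sum {ι : Type*} (s : Finset ι) (f : ι → M01 k) (i : ℕ) :
    (∑ j ∈ s, f j).coeff i = ∑ j ∈ s, (f j).coeff i :=
  map_sum (coeffₗ k i) f s

theorem coeff_eq_zero (x : M01 k) {i : ℕ} (h : ¬ (1 ≤ i ∧ i ≤ 2 * k + 1)) : x.coeff i = 0 :=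
  dif_neg h

theorem coeff_X_self {i : ℕ} (h : 1 ≤ i) (h' : i ≤ 2 * k + 1) : (X k i).coeff i = 1 := by
  rw [coeff_X, if_pos ⟨h, h', rfl⟩]

theorem coeff_X_of_ne {i j : ℕ} (h : j ≠ i) : (X k i).coeff j = 0 := by
  rw [coeff_X, if_neg (by simp [h])]

/-- `form` as a bilinear form on the whole Lie algebra; its radical is spanned by
`X_1`, `X_{2k}` and `X_{2k+1}`. -/
def formₗ (k : ℕ) : LinearMap.BilinForm ℝ (M01 k) :=
  LinearMap.mk₂ ℝ form
    (fun x y z => by rw [form_skew, form_add_right, form_skew z x, form_skew z y]; ring)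
    (fun c x y => by rw [form_skew, form_smul_right, form_skew y x, smul_eq_mul]; ring)
    form_add_right form_smul_right

@[simp] theorem formₗ_apply (x y : M01 k) : formₗ k x y = form x y := rfl

theorem form_X_right (x : M01 k) (j : ℕ) :
    form x (X k j) =
      if 2 ≤ j ∧ j ≤ 2 * k - 1 then (-1 : ℝ) ^ j * x.coeff (2 * k + 1 - j) else 0 := by
  unfold form
  split_ifs with h
  · rcases le_or_gt j k with hj | hj
    · rw [Finset.sum_eq_single j]
      · rw [coeff_X_of_ne (by omega : 2 * k + 1 - j ≠ j), coeff_X_self (by omega) (by omega)]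
        ring
      · intro l hl hne
        have := Finset.mem_Icc.1 hl
        rw [coeff_X_of_ne hne, coeff_X_of_ne (by omega)]
        ring
      · intro hn
        exact absurd (Finset.mem_Icc.2 ⟨h.1, hj⟩) hn
    · rw [Finset.sum_eq_single (2 * k + 1 - j)]
      · rw [coeff_X_of_ne (by omega : 2 * k + 1 - j ≠ j),
          show 2 * k + 1 - (2 * k + 1 - j) = j by omega, coeff_X_self (by omega) (by omega)]
        have : (-1 : ℝ) ^ (2 * k + 1 - j + 1) = (-1) ^ j := by
          rcases Nat.even_or_odd j with hp | hp
          · rw [hp.neg_one_pow, Even.neg_one_pow (by grind)]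
          · rw [hp.neg_one_pow, Odd.neg_one_pow (by grind)]
        rw [this]
        ring
      · intro l hl hne
        have := Finset.mem_Icc.1 hl
        rw [coeff_X_of_ne (by omega : 2 * k + 1 - l ≠ j), coeff_X_of_ne (by omega : l ≠ j)]
        ring
      · intro hn
        exact absurd (Finset.mem_Icc.2 ⟨by omega, by omega⟩) hn
  · refine Finset.sum_eq_zero fun l hl => ?_
    have := Finset.mem_Icc.1 hl
    rw [coeff_X_of_ne (by omega : 2 * k + 1 - l ≠ j), coeff_X_of_ne (by omega : l ≠ j)]
    ring

theorem form_X_right_eq_zero (x : M01 k) {j : ℕ} (h : ¬ (2 ≤ j ∧ j ≤ 2 * k - 1)) :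
    form x (X k j) = 0 := by
  rw [form_X_right, if_neg h]

theorem form_X_left_eq_zero (x : M01 k) {j : ℕ} (h : ¬ (2 ≤ j ∧ j ≤ 2 * k - 1)) :
    form (X k j) x = 0 := by
  rw [form_skew, form_X_right_eq_zero x h, neg_zero]

/-- The radical of `form` on the ideal spanned by `X_2, …, X_{2k+1}`. -/
theorem eq_of_form_X_eq_zero {x : M01 k} (h1 : x.coeff 1 = 0)
    (h : ∀ j, 2 ≤ j → j ≤ 2 * k - 1 → form x (X k j) = 0) :
    x = x.coeff (2 * k) • X k (2 * k) + x.coeff (2 * k + 1) • X k (2 * k + 1) := by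
  refine ext_coeff fun i hi hi' => ?_
  rw [coeff_add, coeff_smul, coeff_smul]
  rcases (by omega : i = 2 * k + 1 ∨ i = 2 * k ∨ i ≤ 2 * k - 1) with rfl | rfl | hi2
  · rw [coeff_X_of_ne (by omega), coeff_X_self (by omega) le_rfl]; ring
  · rw [coeff_X_of_ne (by omega : 2 * k ≠ 2 * k + 1), coeff_X_self hi hi']; ring
  · rw [coeff_X_of_ne (by omega : i ≠ 2 * k), coeff_X_of_ne (by omega : i ≠ 2 * k + 1)]
    rcases (by omega : i = 1 ∨ 2 ≤ i) with rfl | hi3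
    · rw [h1]; ring
    · have := h (2 * k + 1 - i) (by omega) (by omega)
      rw [form_X_right, if_pos (by omega), show 2 * k + 1 - (2 * k + 1 - i) = i by omega] at this
      rcases mul_eq_zero.1 this with h0 | h0
      · exact absurd h0 (pow_ne_zero _ (by norm_num))
      · rw [h0]; ring

theorem lie_of_coeff_one_eq_zero {x y : M01 k} (hx : x.coeff 1 = 0) (hy : y.coeff 1 = 0) :
    ⁅x, y⁆ = form x y • X k (2 * k + 1) := by
  refine ext_coeff fun i hi hi' => ?_
  rw [coeff_lie, coeff_smul, coeff_X, hx, hy]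
  grind

theorem lie_X {x : M01 k} {j : ℕ} (h : 2 ≤ j) (h' : j ≤ 2 * k) :
    ⁅x, X k j⁆ = x.coeff 1 • X k (j + 1) + form x (X k j) • X k (2 * k + 1) := by
  refine ext_coeff fun i hi hi' => ?_
  rw [coeff_lie, coeff_add, coeff_smul, coeff_smul]
  simp only [coeff_X]
  grind

theorem lie_X_last (x : M01 k) (hk : 1 ≤ k) : ⁅x, X k (2 * k + 1)⁆ = 0 := by
  refine ext_coeff fun i hi hi' => ?_
  rw [coeff_lie, form_X_right_eq_zero x (by omega), coeff_zero]
  simp only [coeff_X]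
  grind

theorem X_ne_zero {i : ℕ} (h : 1 ≤ i) (h' : i ≤ 2 * k + 1) : X k i ≠ 0 := by
  intro h0
  have := coeff_X_self (k := k) h h'
  rw [h0, coeff_zero] at this
  exact zero_ne_one this

/-- If a subalgebra contains an element with nonzero `X_1`-coefficient and an element of the ideal
`⟨X_2, …, X_{2k+1}⟩` whose first nonzero coefficient is that of `X_i`, then bracketing the second
repeatedly with the first shows that it contains all of `⟨X_i, …, X_{2k+1}⟩`. -/
theorem mem_of_leading_coeff {h : LieSubalgebra ℝ (M01 k)} {y₀ : M01 k} (hy₀ : y₀ ∈ h)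
    (h₀ : y₀.coeff 1 ≠ 0) (n : ℕ) : ∀ i, 2 ≤ i → i + n = 2 * k + 1 → ∀ y ∈ h,
      (∀ j < i, y.coeff j = 0) → y.coeff i ≠ 0 →
      ∀ x : M01 k, (∀ j < i, x.coeff j = 0) → x ∈ h := by
  induction n with
  | zero =>
    intro i hi hin y hy hlow hne x hx
    have : x = (x.coeff i / y.coeff i) • y := by
      refine ext_coeff fun j hj hj' => ?_
      rw [coeff_smul]
      rcases (by omega : j < i ∨ j = i) with hji | rfl
      · rw [hx j hji, hlow j hji, mul_zero]
      · field_simp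
    rw [this]
    exact h.smul_mem _ hy
  | succ n ih =>
    intro i hi hin y hy hlow hne x hx
    have hsub : x - (x.coeff i / y.coeff i) • y ∈ h := by
      refine ih (i + 1) (by omega) (by omega) ⁅y₀, y⁆ (h.lie_mem hy₀ hy) ?_ ?_ _ ?_
      · intro j hj
        rw [coeff_lie, hlow 1 (by omega), hlow (j - 1) (by omega), if_neg (by omega : j ≠ 2 * k + 1)]
        simp
      · have hform : i + 1 = 2 * k + 1 → form y₀ y = 0 := by
          intro hi'
          rw [form_skew]
          unfold form
          rw [neg_eq_zero]
          refine Finset.sum_eq_zero fun l hl => ?_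
          have := Finset.mem_Icc.1 hl
          rw [hlow l (by omega), hlow (2 * k + 1 - l) (by omega)]
          ring
        rw [coeff_lie, if_pos (by omega), if_pos (by omega), hlow 1 (by omega), Nat.add_sub_cancel]
        split_ifs with hi'
        · rw [hform hi']; simpa using ⟨h₀, hne⟩
        · simpa using ⟨h₀, hne⟩
      · intro j hj
        rw [coeff_sub, coeff_smul]
        rcases (by omega : j < i ∨ j = i) with hji | rfl
        · rw [hx j hji, hlow j hji]; ring
        · field_simp; ring
    have := h.add_mem hsub (h.smul_mem (x.coeff i / y.coeff i) hy)
    rwa [sub_add_cancel] at this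

end M01

/-! ### Inner product cores as bilinear forms -/

section InnerProduct

variable {E : Type*} [AddCommGroup E] [Module ℝ E]

namespace InnerProductSpace.Core

theorem real_inner_comm' (I : InnerProductSpace.Core ℝ E) (x y : E) :
    I.inner x y = I.inner y x := by
  simpa using (I.conj_inner_symm x y).symm

/-- The inner product `I` as a bilinear form. -/
def bilinForm (I : InnerProductSpace.Core ℝ E) : LinearMap.BilinForm ℝ E :=
  LinearMap.mk₂ ℝ I.inner I.add_left (fun c x y => by simpa using I.smul_left x y c)
    (fun x y z => by
      rw [I.real_inner_comm', I.add_left, I.real_inner_comm' y, I.real_inner_comm' z])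
    (fun c x y => by
      rw [I.real_inner_comm', I.real_inner_comm' x]; simpa using I.smul_left y x c)

variable (I : InnerProductSpace.Core ℝ E)

theorem eq_zero_of_bilinForm_self {x : E} (h : I.bilinForm x x = 0) : x = 0 :=
  I.definite x h

theorem exists_add_eq [FiniteDimensional ℝ E] (S : Submodule ℝ E) (x : E) :
    ∃ a ∈ S, ∃ b, (∀ w ∈ S, I.bilinForm b w = 0) ∧ a + b = x := by
  let := I.toNormedAddCommGroup
  let := InnerProductSpace.ofCore I.toCore
  obtain ⟨a, ha, b, hb, rfl⟩ := S.exists_add_mem_mem_orthogonal x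
  exact ⟨a, ha, b, fun w hw => (S.mem_orthogonal' b).1 hb w hw, rfl⟩

end InnerProductSpace.Core

end InnerProduct

/-! ### The lower bound on the codimension -/

namespace M01

variable {k : ℕ}

section TotallyGeodesic

variable {I : InnerProductSpace.Core ℝ (M01 k)} {h : LieSubalgebra ℝ (M01 k)}

theorem bilinForm_lie_X_last (hk : 1 ≤ k) (hI : IsTotallyGeodesic I h)
    (hz : X k (2 * k + 1) ∈ h) {x y : M01 k} (hx : ∀ w ∈ h, I.bilinForm x w = 0) (hy : y ∈ h) :
    I.bilinForm ⁅x, y⁆ (X k (2 * k + 1)) = 0 := by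
  have h1 : I.bilinForm ⁅x, y⁆ (X k (2 * k + 1)) + I.bilinForm ⁅x, X k (2 * k + 1)⁆ y = 0 :=
    hI x hx y hy _ hz
  rwa [lie_X_last x hk, map_zero, LinearMap.zero_apply, add_zero] at h1

theorem bilinForm_X_last_ne_zero :
    I.bilinForm (X k (2 * k + 1)) (X k (2 * k + 1)) ≠ 0 := fun h0 =>
  X_ne_zero (by omega) le_rfl (I.eq_zero_of_bilinForm_self h0)

theorem form_eq_zero_of_orthogonal (hk : 1 ≤ k) (hI : IsTotallyGeodesic I h)
    (hz : X k (2 * k + 1) ∈ h) {x y : M01 k} (hx : ∀ w ∈ h, I.bilinForm x w = 0)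
    (hx1 : x.coeff 1 = 0) (hy : y ∈ h) (hy1 : y.coeff 1 = 0) : form x y = 0 := by
  have h1 := bilinForm_lie_X_last hk hI hz hx hy
  rw [lie_of_coeff_one_eq_zero hx1 hy1, map_smul, LinearMap.smul_apply, smul_eq_mul] at h1
  exact (mul_eq_zero.1 h1).resolve_right bilinForm_X_last_ne_zero

/-- A proper totally geodesic subalgebra of dimension at least `4` lies in the ideal
`⟨X_2, …, X_{2k+1}⟩`. Otherwise it contains `X_{2k-1}`, `X_{2k}` and `X_{2k+1}`, which forces the
first two coefficients of its orthogonal complement to vanish. -/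
theorem coeff_one_eq_zero_of_isTotallyGeodesic (hk : 3 ≤ k) (hI : IsTotallyGeodesic I h)
    (htop : h ≠ ⊤) (hdim : 4 ≤ Module.finrank ℝ h) : ∀ y ∈ h, y.coeff 1 = 0 := by
  by_contra! hne
  obtain ⟨y₀, hy₀, h₀⟩ := hne
  -- three linear conditions on a space of dimension at least four
  let L : h.toSubmodule →ₗ[ℝ] (Fin 3 → ℝ) :=
    (LinearMap.pi ![coeffₗ k 1, coeffₗ k (2 * k), coeffₗ k (2 * k + 1)]).comp h.toSubmodule.subtype
  have hker : LinearMap.ker L ≠ ⊥ := by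
    refine LinearMap.ker_ne_bot_of_finrank_lt ?_
    rw [Module.finrank_fin_fun]
    exact hdim
  obtain ⟨⟨y, hy⟩, hyL, hy0⟩ := (Submodule.ne_bot_iff _).1 hker
  have hL : ∀ i, L ⟨y, hy⟩ i = 0 := fun i => by rw [LinearMap.mem_ker.1 hyL]; rfl
  have hy1 : y.coeff 1 = 0 := hL 0
  have hy2 : y.coeff (2 * k) = 0 := hL 1
  have hy3 : y.coeff (2 * k + 1) = 0 := hL 2
  have hex : ∃ i, y.coeff i ≠ 0 := by
    by_contra! hall
    exact hy0 (Subtype.ext (ext_coeff fun i _ _ => by rw [hall i]; exact (coeff_zero i).symm))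
  classical
  have hlead := Nat.find_spec hex
  have hmin : ∀ j < Nat.find hex, y.coeff j = 0 := fun j hj => by
    simpa using Nat.find_min hex hj
  set i := Nat.find hex
  have hi : 1 ≤ i ∧ i ≤ 2 * k + 1 := by
    by_contra hcon
    exact hlead (coeff_eq_zero y hcon)
  have hi1 : i ≠ 1 := fun e => hlead (e ▸ hy1)
  have hi2 : i ≠ 2 * k := fun e => hlead (e ▸ hy2)
  have hi3 : i ≠ 2 * k + 1 := fun e => hlead (e ▸ hy3)
  have hmem : ∀ x : M01 k, (∀ j < i, x.coeff j = 0) → x ∈ h :=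
    mem_of_leading_coeff hy₀ h₀ (2 * k + 1 - i) i (by omega) (by omega) y hy hmin hlead
  have hX : ∀ j, 2 * k - 1 ≤ j → X k j ∈ h := fun j hj =>
    hmem _ fun l hl => coeff_X_of_ne (by omega)
  have hz := hX (2 * k + 1) (by omega)
  have horth1 : ∀ x, (∀ w ∈ h, I.bilinForm x w = 0) → x.coeff 1 = 0 := fun x hx => by
    have h1 := bilinForm_lie_X_last (by omega) hI hz hx (hX (2 * k) (by omega))
    rw [lie_X (by omega) le_rfl, form_X_right_eq_zero x (by omega), zero_smul, add_zero, map_smul,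
      LinearMap.smul_apply, smul_eq_mul] at h1
    exact (mul_eq_zero.1 h1).resolve_right bilinForm_X_last_ne_zero
  have horth2 : ∀ x, (∀ w ∈ h, I.bilinForm x w = 0) → x.coeff 2 = 0 := fun x hx => by
    have h1 := form_eq_zero_of_orthogonal (by omega) hI hz hx (horth1 x hx)
      (hX (2 * k - 1) le_rfl) (coeff_X_of_ne (by omega))
    rw [form_X_right, if_pos (by omega), show 2 * k + 1 - (2 * k - 1) = 2 by omega] at h1
    exact (mul_eq_zero.1 h1).resolve_left (pow_ne_zero _ (by norm_num))
  obtain ⟨a, ha, b, hb, hab⟩ := I.exists_add_eq h.toSubmodule (X k 2)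
  have ha1 : a.coeff 1 = 0 := by
    have := congrArg (coeff · 1) hab
    simp only [coeff_add, horth1 b hb, coeff_X_of_ne (show 1 ≠ 2 by omega)] at this
    linarith
  have ha2 : a.coeff 2 ≠ 0 := by
    have := congrArg (coeff · 2) hab
    simp only [coeff_add, horth2 b hb, coeff_X_self (show 1 ≤ 2 by omega)
      (show 2 ≤ 2 * k + 1 by omega)] at this
    intro h0
    linarith
  have hlow : ∀ x : M01 k, x.coeff 1 = 0 → ∀ j < 2, x.coeff j = 0 := fun x hx j hj => by
    rcases (by omega : j = 0 ∨ j = 1) with rfl | rfl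
    · exact coeff_eq_zero x (by omega)
    · exact hx
  have hV : ∀ x : M01 k, x.coeff 1 = 0 → x ∈ h := fun x hx =>
    mem_of_leading_coeff hy₀ h₀ (2 * k - 1) 2 le_rfl (by omega) a ha (hlow a ha1) ha2 x (hlow x hx)
  refine htop (eq_top_iff.2 fun x _ => ?_)
  have := h.add_mem (hV (x - (x.coeff 1 / y₀.coeff 1) • y₀) ?_)
    (h.smul_mem (x.coeff 1 / y₀.coeff 1) hy₀)
  · rwa [sub_add_cancel] at this
  · rw [coeff_sub, coeff_smul]
    field_simp
    ring

end TotallyGeodesic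

/-- A subalgebra of `⟨X_2, …, X_{2k+1}⟩` which does not contain `X_{2k+1}` is isotropic for
`form`, and an isotropic subspace avoiding `X_{2k+1}` has dimension at most `k`. -/
theorem X_last_mem_of_finrank (hk : 3 ≤ k) (h : LieSubalgebra ℝ (M01 k))
    (h1 : ∀ y ∈ h, y.coeff 1 = 0) (hdim : 2 * k - 2 ≤ Module.finrank ℝ h) :
    X k (2 * k + 1) ∈ h := by
  by_contra hz
  have hiso : ∀ a ∈ h, ∀ b ∈ h, form a b = 0 := fun a ha b hb => by
    by_contra hne
    have := h.lie_mem ha hb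
    rw [lie_of_coeff_one_eq_zero (h1 a ha) (h1 b hb)] at this
    exact hz ((h.toSubmodule.smul_mem_iff hne).1 this)
  have hrefl : (formₗ k).IsRefl := fun x y hxy => by
    rw [formₗ_apply, form_skew]
    simpa using hxy
  have hsum := LinearMap.BilinForm.finrank_add_finrank_orthogonal hrefl h.toSubmodule
  -- the orthogonal contains the subspace together with `X_1` and `X_{2k+1}`
  have hlarge : Module.finrank ℝ h + 2 ≤
      Module.finrank ℝ ((formₗ k).orthogonal h.toSubmodule) := by
    let L : (h.toSubmodule × ℝ × ℝ) →ₗ[ℝ] M01 k :=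
      h.toSubmodule.subtype.coprod
        ((LinearMap.toSpanSingleton ℝ _ (X k 1)).coprod
          (LinearMap.toSpanSingleton ℝ _ (X k (2 * k + 1))))
    have hL : ∀ p, L p = p.1 + (p.2.1 • X k 1 + p.2.2 • X k (2 * k + 1)) := fun p => rfl
    have hmem : ∀ p, L p ∈ (formₗ k).orthogonal h.toSubmodule := fun p w hw => by
      rw [hL, map_add, map_add, map_smul, map_smul, formₗ_apply, formₗ_apply, formₗ_apply,
        hiso w hw _ p.1.2, form_X_right_eq_zero w (by omega), form_X_right_eq_zero w (by omega)]
      simp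
    have hinj : Function.Injective (L.codRestrict _ hmem) := by
      rw [← LinearMap.ker_eq_bot, LinearMap.ker_codRestrict, LinearMap.ker_eq_bot']
      rintro ⟨⟨a, ha⟩, s, t⟩ hp
      rw [hL] at hp
      simp only at hp
      have hs : s = 0 := by
        have := congrArg (coeff · 1) hp
        simpa [coeff_add, coeff_smul, coeff_zero, h1 a ha, coeff_X_of_ne (k := k)
          (show 1 ≠ 2 * k + 1 by omega), coeff_X_self (k := k) (le_refl 1) (by omega)] using this
      subst hs
      have ht : t = 0 := by
        by_contra hne
        rw [zero_smul, zero_add] at hp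
        refine hz ((h.toSubmodule.smul_mem_iff hne).1 ?_)
        rw [← neg_eq_of_add_eq_zero_right hp]
        exact h.toSubmodule.neg_mem ha
      subst ht
      simpa using hp
    have := LinearMap.finrank_le_finrank_of_injective hinj
    rwa [Module.finrank_prod, Module.finrank_prod, Module.finrank_self] at this
  -- the radical meets the subspace in dimension at most one
  have hsmall :
      Module.finrank ℝ (h.toSubmodule ⊓ (formₗ k).orthogonal ⊤ : Submodule ℝ (M01 k)) ≤ 1 := by
    let L : (h.toSubmodule ⊓ (formₗ k).orthogonal ⊤ : Submodule ℝ (M01 k)) →ₗ[ℝ] ℝ :=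
      (coeffₗ k (2 * k)).comp (Submodule.subtype _)
    have hinj : Function.Injective L := by
      rw [← LinearMap.ker_eq_bot, LinearMap.ker_eq_bot']
      rintro ⟨a, ha, ha'⟩ hp
      have hp' : a.coeff (2 * k) = 0 := hp
      have hrad := eq_of_form_X_eq_zero (h1 a ha) fun j _ _ => by
        rw [form_skew, neg_eq_zero]
        exact ha' (X k j) trivial
      rw [hp', zero_smul, zero_add] at hrad
      by_cases h0 : a.coeff (2 * k + 1) = 0
      · rw [h0, zero_smul] at hrad
        exact Subtype.ext hrad
      · exact absurd ((h.toSubmodule.smul_mem_iff h0).1 (hrad ▸ ha)) hz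
    simpa using LinearMap.finrank_le_finrank_of_injective hinj
  rw [finrank_eq] at hsum
  change Module.finrank ℝ h + _ = _ at hsum
  omega

section TotallyGeodesic

variable {I : InnerProductSpace.Core ℝ (M01 k)} {h : LieSubalgebra ℝ (M01 k)}

/-- The case of a subalgebra contained in the ideal `⟨X_2, …, X_{2k+1}⟩`. The part of the orthogonal
complement lying in this ideal is `form`-orthogonal to the subalgebra, hence is a line spanned by
a vector congruent to `X_{2k}` modulo `X_{2k+1}`. Modulo that line the bracket with an orthogonal
vector having `X_1`-coefficient `1` acts nilpotently, which contradicts skew-symmetry on the pair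
`X_{2k-2}, X_{2k-1}`. -/
theorem not_isTotallyGeodesic_of_coeff_one_eq_zero (hk : 3 ≤ k)
    (h1 : ∀ y ∈ h, y.coeff 1 = 0)
    (hcodim : Module.finrank ℝ (M01 k ⧸ h.toSubmodule) ≤ 3) :
    ¬ IsTotallyGeodesic I h := by
  intro hI
  have hdim : 2 * k - 2 ≤ Module.finrank ℝ h := by
    have := h.toSubmodule.finrank_quotient_add_finrank
    rw [finrank_eq] at this
    change _ + Module.finrank ℝ h = _ at this
    omega
  have hz := X_last_mem_of_finrank hk h h1 hdim
  set z := X k (2 * k + 1) with hzdef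
  have hk1 : 1 ≤ k := by omega
  have hz1 : z.coeff 1 = 0 := coeff_X_of_ne (by omega)
  have hr1 : (X k (2 * k)).coeff 1 = 0 := coeff_X_of_ne (by omega)
  -- an orthogonal vector with `X_1`-coefficient one
  obtain ⟨t₀, ht₀, t, ht, hsumt⟩ := I.exists_add_eq h.toSubmodule (X k 1)
  have ht1 : t.coeff 1 = 1 := by
    have := congrArg (coeff · 1) hsumt
    simpa [coeff_add, h1 t₀ ht₀, coeff_X_self (k := k) (le_refl 1) (by omega)] using this
  have hdec : ∀ x : M01 k, x.coeff 1 = 0 → ∃ a ∈ h, ∃ b, (∀ w ∈ h, I.bilinForm b w = 0) ∧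
      b.coeff 1 = 0 ∧ a + b = x := fun x hx => by
    obtain ⟨a, ha, b, hb, hab⟩ := I.exists_add_eq h.toSubmodule x
    refine ⟨a, ha, b, hb, ?_, hab⟩
    rw [← hab, coeff_add, h1 a ha, zero_add] at hx
    exact hx
  have hform : ∀ b, (∀ w ∈ h, I.bilinForm b w = 0) → b.coeff 1 = 0 → ∀ a ∈ h, form b a = 0 :=
    fun b hb hb1 a ha => form_eq_zero_of_orthogonal hk1 hI hz hb hb1 ha (h1 a ha)
  -- an orthogonal vector congruent to `X_{2k}` modulo `X_{2k+1}`
  obtain ⟨β, hr⟩ : ∃ β : ℝ, ∀ w ∈ h, I.bilinForm (X k (2 * k) - β • z) w = 0 := by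
    obtain ⟨a, ha, b, hb, hb1, hab⟩ := hdec _ hr1
    have harad := eq_of_form_X_eq_zero (h1 a ha) fun j hj hj' => by
      obtain ⟨a', ha', b', hb', hb1', hab'⟩ := hdec (X k j) (coeff_X_of_ne (by omega))
      have e1 : form a a' = 0 := by
        have : formₗ k a a' + formₗ k b a' = formₗ k (X k (2 * k)) a' := by
          rw [← hab, map_add, LinearMap.add_apply]
        rw [formₗ_apply, formₗ_apply, formₗ_apply, hform b hb hb1 a' ha',
          form_X_left_eq_zero a' (by omega)] at this
        linarith
      rw [← hab', form_add_right, e1, form_skew a b', hform b' hb' hb1' a ha]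
      ring
    have hcoef : a.coeff (2 * k) = 0 := by
      have e := bilinForm_lie_X_last hk1 hI hz ht ha
      rw [harad, lie_add, lie_smul, lie_smul, lie_X_last t hk1, lie_X (by omega) le_rfl,
        form_X_right_eq_zero t (by omega), ht1, one_smul, zero_smul, add_zero, smul_zero, add_zero,
        map_smul, LinearMap.smul_apply, smul_eq_mul] at e
      exact (mul_eq_zero.1 e).resolve_right bilinForm_X_last_ne_zero
    rw [hcoef, zero_smul, zero_add] at harad
    refine ⟨a.coeff (2 * k + 1), ?_⟩
    rw [← hzdef] at harad
    rw [← harad, ← hab, add_sub_cancel_left]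
    exact hb
  set r := X k (2 * k) - β • z with hrdef
  have hrc1 : r.coeff 1 = 0 := by rw [hrdef, coeff_sub, coeff_smul, hr1, hz1]; ring
  have hself : ∀ x ∈ h, (∀ w ∈ h, I.bilinForm x w = 0) → x = 0 := fun x hx hx' =>
    I.eq_zero_of_bilinForm_self (hx' x hx)
  have hr0 : r ≠ 0 := fun h0 => by
    have := congrArg (coeff · (2 * k)) h0
    simp [hrdef, hzdef, coeff_sub, coeff_smul, coeff_zero, coeff_X_of_ne (k := k)
      (show 2 * k ≠ 2 * k + 1 by omega), coeff_X_self (k := k) (show 1 ≤ 2 * k by omega)] at this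
  -- the orthogonal vectors with vanishing `X_1`-coefficient form a line
  have hline : ∀ w, (∀ y ∈ h, I.bilinForm w y = 0) → w.coeff 1 = 0 → ∃ c : ℝ, w = c • r := by
    intro w hw hw1
    by_contra! hne
    have hli : LinearIndependent ℝ (h.toSubmodule.mkQ ∘ ![t, r, w]) := by
      rw [Fintype.linearIndependent_iff]
      intro g hg
      have hg' : g 0 • t + g 1 • r + g 2 • w ∈ h.toSubmodule := by
        rw [← Submodule.Quotient.mk_eq_zero, ← Submodule.mkQ_apply]
        simpa [Fin.sum_univ_three] using hg
      have h0 : g 0 • t + g 1 • r + g 2 • w = 0 := by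
        refine hself _ hg' fun y hy => ?_
        simp [ht y hy, hr y hy, hw y hy]
      have g0 : g 0 = 0 := by
        have := congrArg (coeff · 1) h0
        simpa [coeff_add, coeff_smul, coeff_zero, ht1, hrc1, hw1] using this
      rw [g0, zero_smul, zero_add] at h0
      have g2 : g 2 = 0 := by
        by_contra hg2
        refine hne (-(g 2)⁻¹ * g 1) ?_
        have : g 2 • w = -(g 1 • r) := eq_neg_of_add_eq_zero_right h0
        rw [mul_smul, neg_smul, ← smul_neg, ← this, inv_smul_smul₀ hg2]
      rw [g2, zero_smul, add_zero] at h0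
      have g1 : g 1 = 0 := (smul_eq_zero.1 h0).resolve_right hr0
      intro i
      fin_cases i
      exacts [g0, g1, g2]
    have hspan : ⊤ ≤ Submodule.span ℝ (Set.range (h.toSubmodule.mkQ ∘ ![t, r, w])) := by
      refine (hli.span_eq_top_of_card_eq_finrank' ?_).ge
      refine le_antisymm hli.fintype_card_le_finrank ?_
      simpa using hcodim
    have hwform : ∀ x : M01 k, x.coeff 1 = 0 → form w x = 0 := fun x hx => by
      obtain ⟨g, hg⟩ := (Submodule.mem_span_range_iff_exists_fun ℝ).1
        (hspan (Submodule.mem_top (x := h.toSubmodule.mkQ x)))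
      have ha : x - (g 0 • t + g 1 • r + g 2 • w) ∈ h.toSubmodule := by
        rw [← Submodule.Quotient.mk_eq_zero, ← Submodule.mkQ_apply, map_sub, ← hg]
        simp [Fin.sum_univ_three]
      have g0 : g 0 = 0 := by
        have := h1 _ ha
        rw [coeff_sub, coeff_add, coeff_add, coeff_smul, coeff_smul, coeff_smul, hx, ht1, hrc1,
          hw1] at this
        linarith
      have e := hform w hw hw1 _ ha
      rw [g0, zero_smul, zero_add, ← formₗ_apply, map_sub, map_add, map_smul, map_smul, hrdef,
        map_sub, map_smul] at e
      simp only [formₗ_apply, form_self, hzdef, form_X_right_eq_zero w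
        (show ¬ (2 ≤ 2 * k ∧ 2 * k ≤ 2 * k - 1) by omega), form_X_right_eq_zero w
        (show ¬ (2 ≤ 2 * k + 1 ∧ 2 * k + 1 ≤ 2 * k - 1) by omega)] at e
      simpa using e
    have hwrad := eq_of_form_X_eq_zero hw1 fun j hj _ =>
      hwform (X k j) (coeff_X_of_ne (by omega))
    set c := w.coeff (2 * k)
    set d := w.coeff (2 * k + 1)
    refine hne c (sub_eq_zero.1 (hself _ ?_ fun y hy => ?_))
    · have : w - c • r = (d + c * β) • z := by
        rw [hwrad, hrdef, smul_sub, add_smul, mul_smul]; abel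
      rw [this]
      exact h.smul_mem _ hz
    · simp [hw y hy, hr y hy]
  -- representatives in the subalgebra, orthogonal to `X_{2k+1}`
  have hrep : ∀ j, 2 ≤ j → ∃ y ∈ h, I.bilinForm z y = 0 ∧
      ∃ b c : ℝ, X k j = y + b • r + c • z := fun j hj => by
    obtain ⟨a, ha, b, hb, hb1, hab⟩ := hdec (X k j) (coeff_X_of_ne (by omega))
    obtain ⟨b', rfl⟩ := hline b hb hb1
    set c := I.bilinForm z a / I.bilinForm z z
    refine ⟨a - c • z, h.sub_mem ha (h.smul_mem _ hz), ?_, b', c, ?_⟩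
    · rw [map_sub, map_smul, smul_eq_mul, div_mul_cancel₀ _ bilinForm_X_last_ne_zero, sub_self]
    · rw [← hab]; abel
  obtain ⟨y, hy, hzy, b, c, hyX⟩ := hrep (2 * k - 2) (by omega)
  obtain ⟨x, hx, hzx, b', c', hxX⟩ := hrep (2 * k - 1) (by omega)
  have htz : ⁅t, z⁆ = 0 := lie_X_last t hk1
  have htr : ⁅t, r⁆ = z := by
    rw [hrdef, lie_sub, lie_smul, htz, lie_X (by omega) le_rfl, form_X_right_eq_zero t (by omega),
      ht1]
    simp [hzdef]
  have hty : ⁅t, y⁆ = X k (2 * k - 1) + (form t (X k (2 * k - 2)) - b) • z := by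
    have := lie_X (x := t) (j := 2 * k - 2) (by omega) (by omega)
    rw [show 2 * k - 2 + 1 = 2 * k - 1 by omega, ht1, one_smul, ← hzdef] at this
    rw [eq_sub_of_add_eq (eq_sub_of_add_eq hyX.symm), lie_sub, lie_sub, lie_smul, lie_smul, htz,
      htr, this, sub_smul, smul_zero]
    abel
  have htx : ⁅t, x⁆ = r + (β + form t (X k (2 * k - 1)) - b') • z := by
    have := lie_X (x := t) (j := 2 * k - 1) (by omega) (by omega)
    rw [show 2 * k - 1 + 1 = 2 * k by omega, ht1, one_smul, ← hzdef] at this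
    rw [eq_sub_of_add_eq (eq_sub_of_add_eq hxX.symm), lie_sub, lie_sub, lie_smul, lie_smul, htz,
      htr, this, sub_smul, add_smul, smul_zero, hrdef]
    abel
  have key : I.bilinForm ⁅t, y⁆ x + I.bilinForm ⁅t, x⁆ y = 0 := hI t ht y hy x hx
  rw [hty, htx, hxX] at key
  simp only [map_add, map_smul, LinearMap.add_apply, LinearMap.smul_apply, hzx, hzy, hr x hx,
    hr y hy, smul_zero, add_zero] at key
  have hx0 := I.eq_zero_of_bilinForm_self key
  have := congrArg (coeff · (2 * k - 1)) hxX
  simp [hx0, hrdef, hzdef, coeff_add, coeff_sub, coeff_smul,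
    coeff_X_self (k := k) (show 1 ≤ 2 * k - 1 by omega) (by omega),
    coeff_X_of_ne (k := k) (show 2 * k - 1 ≠ 2 * k by omega),
    coeff_X_of_ne (k := k) (show 2 * k - 1 ≠ 2 * k + 1 by omega)] at this

theorem four_le_codim (hk : 3 ≤ k) (htop : h ≠ ⊤) (hI : IsTotallyGeodesic I h) :
    4 ≤ Module.finrank ℝ (M01 k ⧸ h.toSubmodule) := by
  by_contra! hlt
  have hdim := h.toSubmodule.finrank_quotient_add_finrank
  rw [finrank_eq] at hdim
  change _ + Module.finrank ℝ h = _ at hdim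
  exact not_isTotallyGeodesic_of_coeff_one_eq_zero hk
    (coeff_one_eq_zero_of_isTotallyGeodesic hk hI htop (by omega)) (by omega) hI

end TotallyGeodesic

end M01

/-! ### Totally geodesic subalgebras from an orthonormal basis -/

section OrthonormalBasis

variable {ι E : Type*} [Fintype ι] [AddCommGroup E] [Module ℝ E]

/-- The inner product for which the basis `b` is orthonormal. -/
@[reducible] noncomputable def Module.Basis.innerCore (b : Module.Basis ι ℝ E) :
    InnerProductSpace.Core ℝ E where
  inner x y := ∑ i, b.repr x i * b.repr y i
  conj_inner_symm x y := by simp [mul_comm]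
  re_inner_nonneg x := by
    simpa using Finset.sum_nonneg fun i _ => mul_self_nonneg (b.repr x i)
  add_left x y z := by simp [add_mul, Finset.sum_add_distrib]
  smul_left x y r := by simp [Finset.mul_sum, mul_assoc]
  definite x hx := by
    have h := (Finset.sum_eq_zero_iff_of_nonneg fun i _ => mul_self_nonneg (b.repr x i)).1 hx
    refine b.repr.map_eq_zero_iff.1 (Finsupp.ext fun i => ?_)
    simpa using h i (Finset.mem_univ i)

theorem Module.Basis.bilinForm_innerCore (b : Module.Basis ι ℝ E) (x : E) (i : ι) :
    b.innerCore.bilinForm x (b i) = b.repr x i := by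
  classical
  change ∑ j, b.repr x j * b.repr (b i) j = _
  simp [Finsupp.single_apply]

end OrthonormalBasis

/-- A subalgebra spanned by part of an orthonormal basis is totally geodesic as soon as bracketing
with each of the remaining basis vectors has a skew-symmetric compression to it. -/
theorem isTotallyGeodesic_innerCore {α β g : Type*} [Fintype α] [Fintype β] [LieRing g]
    [LieAlgebra ℝ g] (b : Module.Basis (α ⊕ β) ℝ g) (h : LieSubalgebra ℝ g)
    (hspan : h.toSubmodule = Submodule.span ℝ (Set.range (b ∘ Sum.inl)))
    (hskew : ∀ j i i', b.repr ⁅b (Sum.inr j), b (Sum.inl i)⁆ (Sum.inl i') +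
      b.repr ⁅b (Sum.inr j), b (Sum.inl i')⁆ (Sum.inl i) = 0) :
    IsTotallyGeodesic b.innerCore h := by
  intro x hx y hy z hz
  change b.innerCore.bilinForm ⁅x, y⁆ z + b.innerCore.bilinForm ⁅x, z⁆ y = 0
  have hx' : x ∈ Submodule.span ℝ (Set.range (b ∘ Sum.inr)) := by
    rw [← b.sum_repr x, Fintype.sum_sum_type]
    have h0 : ∀ i, b.repr x (Sum.inl i) = 0 := fun i => by
      rw [← b.bilinForm_innerCore]
      refine hx _ ?_
      rw [← LieSubalgebra.mem_toSubmodule, hspan]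
      exact Submodule.subset_span ⟨i, rfl⟩
    simp only [h0, zero_smul, Finset.sum_const_zero, zero_add]
    exact Submodule.sum_mem _ fun j _ =>
      Submodule.smul_mem _ _ (Submodule.subset_span ⟨j, rfl⟩)
  rw [← LieSubalgebra.mem_toSubmodule, hspan] at hy hz
  clear hx
  induction hx' using Submodule.span_induction with
  | zero => simp
  | add u v _ _ hu hv =>
    simp only [add_lie, map_add, LinearMap.add_apply]
    linarith
  | smul c u _ hu =>
    simp only [smul_lie, map_smul, LinearMap.smul_apply, smul_eq_mul]
    linear_combination c * hu
  | mem u hu =>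
    obtain ⟨j, rfl⟩ := hu
    induction hy using Submodule.span_induction with
    | zero => simp
    | add u v _ _ hu hv =>
      simp only [lie_add, map_add, LinearMap.add_apply] at hu hv ⊢
      linarith
    | smul c u _ hu =>
      simp only [lie_smul, map_smul, LinearMap.smul_apply, smul_eq_mul] at hu ⊢
      linear_combination c * hu
    | mem u hu =>
      obtain ⟨i, rfl⟩ := hu
      induction hz using Submodule.span_induction with
      | zero => simp
      | add u v _ _ hu hv =>
        simp only [lie_add, map_add, LinearMap.add_apply] at hu hv ⊢
        linarith
      | smul c u _ hu =>
        simp only [lie_smul, map_smul, LinearMap.smul_apply, smul_eq_mul] at hu ⊢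
        linear_combination c * hu
      | mem u hu =>
        obtain ⟨i', rfl⟩ := hu
        simpa only [Function.comp_apply, b.bilinForm_innerCore] using hskew j i i'

/-! ### Combinations of basis vectors along arithmetic progressions -/

namespace M01

variable {k : ℕ}

/-- The vector `∑_{i < N} f i • X_{2i+s}`. -/
noncomputable def prog (k s N : ℕ) (f : ℕ → ℝ) : M01 k :=
  ∑ i ∈ Finset.range N, f i • X k (2 * i + s)

theorem coeff_prog {s N : ℕ} (f : ℕ → ℝ) {i : ℕ} (h : 1 ≤ 2 * i + s) (h' : 2 * i + s ≤ 2 * k + 1) :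
    (prog k s N f).coeff (2 * i + s) = if i < N then f i else 0 := by
  rw [prog, coeff_sum]
  simp only [coeff_smul]
  split_ifs with hi
  · rw [Finset.sum_eq_single i, coeff_X_self h h', mul_one]
    · intro j _ hj
      rw [coeff_X_of_ne (by omega), mul_zero]
    · intro hn
      exact absurd (Finset.mem_range.2 hi) hn
  · refine Finset.sum_eq_zero fun j hj => ?_
    have := Finset.mem_range.1 hj
    rw [coeff_X_of_ne (by omega), mul_zero]

theorem coeff_prog_eq_zero {s N : ℕ} (f : ℕ → ℝ) {j : ℕ} (h : ∀ i < N, j ≠ 2 * i + s) :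
    (prog k s N f).coeff j = 0 := by
  rw [prog, coeff_sum]
  refine Finset.sum_eq_zero fun i hi => ?_
  rw [coeff_smul, coeff_X_of_ne (h i (Finset.mem_range.1 hi)), mul_zero]

theorem lie_X_one_prog {s N : ℕ} (f : ℕ → ℝ) (h : 2 ≤ s) (h' : 2 * N + s ≤ 2 * k + 2) :
    ⁅X k 1, prog k s N f⁆ = prog k (s + 1) N f := by
  rw [prog, prog, lie_sum]
  refine Finset.sum_congr rfl fun i hi => ?_
  have := Finset.mem_range.1 hi
  rw [lie_smul, lie_X_one k _ (by omega) (by omega), add_assoc]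

theorem form_prog (x : M01 k) (s N : ℕ) (f : ℕ → ℝ) :
    form x (prog k s N f) = ∑ i ∈ Finset.range N, f i * form x (X k (2 * i + s)) := by
  rw [← formₗ_apply, prog, map_sum]
  simp

end M01

/-! ### Square roots of power series and partial geometric sums -/

open PowerSeries in
/-- A truncated square root of a power series with constant coefficient one. -/
theorem PowerSeries.exists_mul_self_coeff (e : ℕ → ℝ) (he : e 0 = 1) (N : ℕ) :
    ∃ C : PowerSeries ℝ, constantCoeff C = 1 ∧ ∀ m ≤ N, coeff m (C * C) = e m := by
  induction N with
  | zero => exact ⟨1, by simp, fun m hm => by simp [Nat.le_zero.1 hm, he]⟩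
  | succ N ih =>
    obtain ⟨C, hC, h⟩ := ih
    -- adding `a X ^ (N + 1)` changes the next coefficient of the square by `2 * a`
    set a : ℝ := (e (N + 1) - coeff (N + 1) (C * C)) / 2 with ha
    set P : PowerSeries ℝ := PowerSeries.C a with hP
    have hexp : (C + X ^ (N + 1) * P) * (C + X ^ (N + 1) * P) =
        C * C + X ^ (N + 1) * (2 * P * C + X ^ (N + 1) * P ^ 2) := by
      ring
    refine ⟨C + X ^ (N + 1) * P, by simp [hC], fun m hm => ?_⟩
    · rw [hexp, map_add]
      rcases (by omega : m ≤ N ∨ m = N + 1) with hm' | rfl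
      · rw [h m hm', coeff_X_pow_mul', if_neg (by omega), add_zero]
      · rw [coeff_X_pow_mul', if_pos le_rfl, Nat.sub_self]
        simp only [map_add, map_mul, map_pow, coeff_zero_eq_constantCoeff, hC, hP, constantCoeff_C,
          constantCoeff_X, map_ofNat, ha]
        rw [zero_pow (by omega)]
        ring

namespace M01

/-- The coefficient of `t ^ m` in `C(t) / (1 - μ t)`. -/
noncomputable def geomCoeff (C : PowerSeries ℝ) (μ : ℝ) (m : ℕ) : ℝ :=
  PowerSeries.coeff m (C * PowerSeries.mk fun n => μ ^ n)

theorem geomCoeff_zero (C : PowerSeries ℝ) (μ : ℝ) :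
    geomCoeff C μ 0 = PowerSeries.coeff 0 C := by
  simp [geomCoeff, PowerSeries.coeff_mul]

theorem geomCoeff_succ (C : PowerSeries ℝ) (μ : ℝ) (m : ℕ) :
    geomCoeff C μ (m + 1) = μ * geomCoeff C μ m + PowerSeries.coeff (m + 1) C := by
  simp only [geomCoeff, PowerSeries.coeff_mul, PowerSeries.coeff_mk]
  rw [Finset.Nat.sum_antidiagonal_succ', Finset.mul_sum, pow_zero, mul_one, add_comm]
  congr 1
  refine Finset.sum_congr rfl fun p _ => ?_
  ring

/-- Since `C` is a unit, the first `K` coefficients of `∑ a i / (1 - μ i t)` vanish, and the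
Vandermonde determinant applies. -/
theorem eq_zero_of_sum_geomCoeff {K : ℕ} {C : PowerSeries ℝ} (hC : PowerSeries.constantCoeff C = 1)
    {μ : Fin K → ℝ} (hμ : Function.Injective μ) {a : Fin K → ℝ}
    (h : ∀ m < K, ∑ i, a i * geomCoeff C (μ i) m = 0) : a = 0 := by
  set S : PowerSeries ℝ := ∑ i, a i • PowerSeries.mk fun n => μ i ^ n with hS
  have hCS : PowerSeries.X ^ K ∣ C * S := by
    rw [PowerSeries.X_pow_dvd_iff]
    intro m hm
    rw [hS, Finset.mul_sum, map_sum, ← h m hm]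
    refine Finset.sum_congr rfl fun i _ => ?_
    rw [mul_smul_comm, PowerSeries.coeff_smul, geomCoeff, smul_eq_mul]
  have hunit : IsUnit C := PowerSeries.isUnit_iff_constantCoeff.2 (by rw [hC]; exact isUnit_one)
  have hdvd := (hunit.dvd_mul_left).1 hCS
  rw [PowerSeries.X_pow_dvd_iff] at hdvd
  refine Matrix.eq_zero_of_forall_pow_sum_mul_pow_eq_zero hμ fun m => ?_
  have := hdvd m m.2
  rw [hS, map_sum] at this
  simpa using this

open Polynomial in
/-- There is a power series `C` with `C(0) = 1` such that `C² = ∏ (1 - μ i t)` up to order `K`;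
equivalently, each `C² / (1 - μ i t)` has vanishing coefficient of `t ^ K`. -/
theorem exists_sum_coeff_mul_geomCoeff_eq_zero {K : ℕ} (μ : Fin K → ℝ) :
    ∃ C : PowerSeries ℝ, PowerSeries.constantCoeff C = 1 ∧
      ∀ i, ∑ j ∈ Finset.range (K + 1),
        PowerSeries.coeff (K - j) C * geomCoeff C (μ i) j = 0 := by
  set q : ℝ[X] := ∏ i, (Polynomial.X - Polynomial.C (μ i)) with hq
  have hmonic : q.Monic := monic_prod_X_sub_C _ _
  have hdeg : q.natDegree = K := by
    rw [hq, natDegree_prod_of_monic _ _ fun i _ => monic_X_sub_C _]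
    simp
  obtain ⟨C, hC, hCC⟩ := PowerSeries.exists_mul_self_coeff (fun m => q.coeff (K - m))
    (by rw [Nat.sub_zero, ← hdeg]; exact hmonic) K
  refine ⟨C, hC, fun i => ?_⟩
  have h1 : ∑ j ∈ Finset.range (K + 1), PowerSeries.coeff (K - j) C * geomCoeff C (μ i) j =
      PowerSeries.coeff K ((C * C) * PowerSeries.mk fun n => μ i ^ n) := by
    rw [mul_assoc, mul_comm, PowerSeries.coeff_mul,
      Finset.Nat.sum_antidiagonal_eq_sum_range_succ_mk]
    exact Finset.sum_congr rfl fun j _ => mul_comm _ _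
  rw [h1, PowerSeries.coeff_mul, ← Finset.Nat.sum_antidiagonal_swap,
    Finset.Nat.sum_antidiagonal_eq_sum_range_succ_mk]
  have h2 : q.eval (μ i) = 0 := by
    rw [hq, eval_prod]
    exact Finset.prod_eq_zero (Finset.mem_univ i) (by simp)
  rw [← h2, eval_eq_sum_range, hdeg]
  refine Finset.sum_congr rfl fun j hj => ?_
  have := Finset.mem_range.1 hj
  simp only [Prod.swap_prod_mk, PowerSeries.coeff_mk]
  rw [hCC _ (by omega), show K - (K - j) = j by omega]

end M01

/-! ### The totally geodesic subalgebra of codimension four -/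

namespace M01

/-- The eigenvector, for the eigenvalue `μ` of the square of the compressed operator `ad X_1`, in
the span of the `X_j` with `j` odd; `μ` is an eigenvalue when the coefficient of `t ^ K` in
`C(t)² / (1 - μ t)` vanishes. -/
noncomputable def oddVec (K : ℕ) (C : PowerSeries ℝ) (μ : ℝ) : M01 (K + 2) :=
  prog (K + 2) 3 K fun i => geomCoeff C μ (K - 1 - i)

/-- The image of `oddVec K C μ` under the compressed operator `ad X_1`. -/
noncomputable def evenVec (K : ℕ) (C : PowerSeries ℝ) (μ : ℝ) : M01 (K + 2) :=
  prog (K + 2) 2 (K + 1) fun i => geomCoeff C μ (K - i)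

/-- The vector which, together with `X_2`, spans the symplectic plane along which `ad X_1` is
compressed. -/
noncomputable def normalVec (K : ℕ) (C : PowerSeries ℝ) : M01 (K + 2) :=
  prog (K + 2) 3 (K + 1) fun i => PowerSeries.coeff (K - i) C

variable {K : ℕ} {C : PowerSeries ℝ}

theorem lie_X_one_oddVec (μ : ℝ) :
    ⁅X (K + 2) 1, oddVec K C μ⁆ = evenVec K C μ - geomCoeff C μ K • X (K + 2) 2 := by
  rw [oddVec, lie_X_one_prog _ (by omega) (by omega), evenVec, prog, prog, Finset.sum_range_succ']
  simp only [Nat.sub_zero, mul_zero, zero_add, add_sub_cancel_right]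
  refine Finset.sum_congr rfl fun i _ => ?_
  rw [show K - 1 - i = K - (i + 1) by omega, show 2 * i + (3 + 1) = 2 * (i + 1) + 2 by omega]

theorem lie_X_one_evenVec (μ : ℝ) :
    ⁅X (K + 2) 1, evenVec K C μ⁆ = μ • oddVec K C μ + normalVec K C := by
  rw [evenVec, lie_X_one_prog _ (by omega) (by omega), oddVec, normalVec, prog, prog, prog,
    Finset.sum_range_succ, Finset.sum_range_succ, Finset.smul_sum,
    ← add_assoc (∑ i ∈ Finset.range K, _), ← Finset.sum_add_distrib, Nat.sub_self, geomCoeff_zero]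
  congr 1
  refine Finset.sum_congr rfl fun i hi => ?_
  have := Finset.mem_range.1 hi
  rw [show K - i = K - 1 - i + 1 by omega, geomCoeff_succ, add_smul, mul_smul]

theorem form_X_two_oddVec (μ : ℝ) : form (X (K + 2) 2) (oddVec K C μ) = 0 := by
  rw [form_skew, form_X_right, if_pos (by omega), oddVec, coeff_prog_eq_zero _ (by omega)]
  simp

theorem form_X_two_evenVec (μ : ℝ) : form (X (K + 2) 2) (evenVec K C μ) = 0 := by
  rw [form_skew, form_X_right, if_pos (by omega), evenVec, coeff_prog_eq_zero _ (by omega)]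
  simp

theorem form_normalVec_oddVec (μ : ℝ) : form (normalVec K C) (oddVec K C μ) = 0 := by
  rw [oddVec, form_prog]
  refine Finset.sum_eq_zero fun i hi => ?_
  rw [form_X_right, normalVec, coeff_prog_eq_zero _ (by omega)]
  simp

theorem form_normalVec_evenVec {μ : ℝ}
    (h : ∑ j ∈ Finset.range (K + 1), PowerSeries.coeff (K - j) C * geomCoeff C μ j = 0) :
    form (normalVec K C) (evenVec K C μ) = 0 := by
  rw [form_skew, normalVec, form_prog, neg_eq_zero, ← neg_eq_zero, ← Finset.sum_neg_distrib, ← h]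
  refine Finset.sum_congr rfl fun i hi => ?_
  have := Finset.mem_range.1 hi
  rw [form_X_right, if_pos (by omega),
    show 2 * (K + 2) + 1 - (2 * i + 3) = 2 * (K - i) + 2 by omega, evenVec,
    coeff_prog _ (by omega) (by omega), if_pos (by omega), show K - (K - i) = i by omega,
    Odd.neg_one_pow ⟨i + 1, by ring⟩]
  ring

theorem coeff_one_oddVec (μ : ℝ) : (oddVec K C μ).coeff 1 = 0 :=
  coeff_prog_eq_zero _ (by omega)

theorem coeff_one_evenVec (μ : ℝ) : (evenVec K C μ).coeff 1 = 0 :=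
  coeff_prog_eq_zero _ (by omega)

theorem coeff_one_normalVec : (normalVec K C).coeff 1 = 0 :=
  coeff_prog_eq_zero _ (by omega)

/-- The vectors `oddVec`, rescaled `evenVec` and `X_{2k+1}` for the eigenvalues `-(lam i)²`, which
span the totally geodesic subalgebra, followed by four vectors spanning a complement. -/
noncomputable def adaptedFamily (C : PowerSeries ℝ) (lam : Fin K → ℝ) :
    (Fin K ⊕ Fin K ⊕ Unit) ⊕ Fin 4 → M01 (K + 2) :=
  Sum.elim
    (Sum.elim (fun i => oddVec K C (-(lam i) ^ 2))
      (Sum.elim (fun i => (lam i)⁻¹ • evenVec K C (-(lam i) ^ 2))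
        fun _ => X (K + 2) (2 * (K + 2) + 1)))
    ![X (K + 2) 1, X (K + 2) 2, normalVec K C, X (K + 2) (2 * (K + 2))]

theorem linearIndependent_adaptedFamily (hC : PowerSeries.constantCoeff C = 1) {lam : Fin K → ℝ}
    (hlam : ∀ i, 0 < lam i) (hinj : Function.Injective lam) :
    LinearIndependent ℝ (adaptedFamily C lam) := by
  have hμ : Function.Injective fun i => -(lam i) ^ 2 := fun i j hij =>
    hinj ((pow_left_inj₀ (hlam i).le (hlam j).le two_ne_zero).1 (neg_injective hij))
  rw [Fintype.linearIndependent_iff]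
  intro g hg
  have E : ∀ j, ∑ i, g (.inl (.inl i)) * (oddVec K C (-(lam i) ^ 2)).coeff j +
      (∑ i, g (.inl (.inr (.inl i))) * ((lam i)⁻¹ * (evenVec K C (-(lam i) ^ 2)).coeff j) +
        g (.inl (.inr (.inr ()))) * (X (K + 2) (2 * (K + 2) + 1)).coeff j) +
      (g (.inr 0) * (X (K + 2) 1).coeff j + g (.inr 1) * (X (K + 2) 2).coeff j +
        g (.inr 2) * (normalVec K C).coeff j + g (.inr 3) * (X (K + 2) (2 * (K + 2))).coeff j)
      = 0 := fun j => by
    have := congrArg (coeff · j) hg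
    simpa [adaptedFamily, coeff_add, coeff_sum, coeff_smul, coeff_zero, Fin.sum_univ_four] using this
  have g0 : g (.inr 0) = 0 := by
    have := E 1
    rw [coeff_X_of_ne (show 1 ≠ 2 * (K + 2) by omega)] at this
    simpa [coeff_one_oddVec, coeff_one_evenVec, coeff_one_normalVec, coeff_X] using this
  have gz : g (.inl (.inr (.inr ()))) = 0 := by
    have h1 : ∀ i, (oddVec K C (-(lam i) ^ 2)).coeff (2 * (K + 2) + 1) = 0 := fun i =>
      coeff_prog_eq_zero _ (by omega)
    have h2 : ∀ i, (evenVec K C (-(lam i) ^ 2)).coeff (2 * (K + 2) + 1) = 0 := fun i =>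
      coeff_prog_eq_zero _ (by omega)
    have h3 : (normalVec K C).coeff (2 * (K + 2) + 1) = 0 := coeff_prog_eq_zero _ (by omega)
    simpa [h1, h2, h3, coeff_X] using E (2 * (K + 2) + 1)
  have g3 : g (.inr 3) = 0 := by
    have h1 : ∀ i, (oddVec K C (-(lam i) ^ 2)).coeff (2 * (K + 2)) = 0 := fun i =>
      coeff_prog_eq_zero _ (by omega)
    have h2 : ∀ i, (evenVec K C (-(lam i) ^ 2)).coeff (2 * (K + 2)) = 0 := fun i =>
      coeff_prog_eq_zero _ (by omega)
    have h3 : (normalVec K C).coeff (2 * (K + 2)) = 0 := coeff_prog_eq_zero _ (by omega)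
    have h4 := coeff_X_self (k := K + 2) (i := 2 * (K + 2)) (by omega) (by omega)
    have := E (2 * (K + 2))
    rw [gz, coeff_X_of_ne (show 2 * (K + 2) ≠ 1 by omega),
      coeff_X_of_ne (show 2 * (K + 2) ≠ 2 by omega)] at this
    simpa [h1, h2, h3, h4] using this
  have g2 : g (.inr 2) = 0 := by
    have h1 : ∀ i, (oddVec K C (-(lam i) ^ 2)).coeff (2 * K + 3) = 0 := fun i =>
      coeff_prog_eq_zero _ (by omega)
    have h2 : ∀ i, (evenVec K C (-(lam i) ^ 2)).coeff (2 * K + 3) = 0 := fun i =>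
      coeff_prog_eq_zero _ (by omega)
    have h3 : (normalVec K C).coeff (2 * K + 3) = 1 := by
      rw [normalVec, coeff_prog _ (by omega) (by omega), if_pos (by omega), Nat.sub_self]
      simpa using hC
    have := E (2 * K + 3)
    rw [gz, g3, g0, coeff_X_of_ne (show 2 * K + 3 ≠ 2 by omega)] at this
    simpa [h1, h2, h3] using this
  have godd : (fun i => g (.inl (.inl i))) = 0 := by
    refine eq_zero_of_sum_geomCoeff hC hμ fun m hm => ?_
    have h1 : ∀ i, (oddVec K C (-(lam i) ^ 2)).coeff (2 * (K - 1 - m) + 3) =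
        geomCoeff C (-(lam i) ^ 2) m := fun i => by
      rw [oddVec, coeff_prog _ (by omega) (by omega), if_pos (by omega),
        show K - 1 - (K - 1 - m) = m by omega]
    have h2 : ∀ i, (evenVec K C (-(lam i) ^ 2)).coeff (2 * (K - 1 - m) + 3) = 0 := fun i =>
      coeff_prog_eq_zero _ (by omega)
    have := E (2 * (K - 1 - m) + 3)
    rw [gz, g3, g2, g0, coeff_X_of_ne (show 2 * (K - 1 - m) + 3 ≠ 2 by omega)] at this
    simpa [h1, h2] using this
  have geven : (fun i => g (.inl (.inr (.inl i))) * (lam i)⁻¹) = 0 := by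
    refine eq_zero_of_sum_geomCoeff hC hμ fun m hm => ?_
    have h1 : ∀ i, (evenVec K C (-(lam i) ^ 2)).coeff (2 * (K - m) + 2) =
        geomCoeff C (-(lam i) ^ 2) m := fun i => by
      rw [evenVec, coeff_prog _ (by omega) (by omega), if_pos (by omega),
        show K - (K - m) = m by omega]
    have h2 : ∀ i, (oddVec K C (-(lam i) ^ 2)).coeff (2 * (K - m) + 2) = 0 := fun i =>
      coeff_prog_eq_zero _ (by omega)
    have := E (2 * (K - m) + 2)
    rw [gz, g3, g2, g0, coeff_X_of_ne (show 2 * (K - m) + 2 ≠ 2 by omega)] at this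
    simpa [h1, h2, mul_assoc] using this
  have geven' : ∀ i, g (.inl (.inr (.inl i))) = 0 := fun i => by
    have := congrFun geven i
    exact (mul_eq_zero.1 this).resolve_right (inv_ne_zero (hlam i).ne')
  have godd' : ∀ i, g (.inl (.inl i)) = 0 := fun i => congrFun godd i
  have g1 : g (.inr 1) = 0 := by
    have := E 2
    rw [gz, g3, g2, g0, coeff_X_self (by omega) (by omega)] at this
    simpa [godd', geven'] using this
  rintro ((i | i | i) | i)
  · exact godd' i
  · exact geven' i
  · exact gz
  · fin_cases i
    exacts [g0, g1, g2, g3]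

theorem coeff_one_adaptedFamily_inl (lam : Fin K → ℝ) (i : Fin K ⊕ Fin K ⊕ Unit) :
    (adaptedFamily C lam (Sum.inl i)).coeff 1 = 0 := by
  rcases i with i | i | i
  · exact coeff_one_oddVec _
  · simp [adaptedFamily, coeff_smul, coeff_one_evenVec]
  · exact coeff_X_of_ne (by omega)

/-- The subalgebra of codimension four. -/
noncomputable def geodesicSubalgebra (C : PowerSeries ℝ) (lam : Fin K → ℝ) :
    LieSubalgebra ℝ (M01 (K + 2)) where
  toSubmodule := Submodule.span ℝ (Set.range (adaptedFamily C lam ∘ Sum.inl))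
  lie_mem' := by
    intro x y hx hy
    have h1 : Submodule.span ℝ (Set.range (adaptedFamily C lam ∘ Sum.inl)) ≤
        LinearMap.ker (coeffₗ (K + 2) 1) := by
      rw [Submodule.span_le]
      rintro _ ⟨i, rfl⟩
      exact coeff_one_adaptedFamily_inl lam i
    have hlie := lie_of_coeff_one_eq_zero (h1 hx) (h1 hy)
    exact hlie ▸ Submodule.smul_mem _ _ (Submodule.subset_span ⟨Sum.inr (Sum.inr ()), rfl⟩)

theorem coeff_one_of_mem_geodesicSubalgebra {lam : Fin K → ℝ} {x : M01 (K + 2)}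
    (hx : x ∈ geodesicSubalgebra C lam) : x.coeff 1 = 0 := by
  have h1 : (geodesicSubalgebra C lam).toSubmodule ≤ LinearMap.ker (coeffₗ (K + 2) 1) := by
    refine Submodule.span_le.2 ?_
    rintro _ ⟨i, rfl⟩
    exact coeff_one_adaptedFamily_inl lam i
  exact h1 hx

/-- The only bracket between the complement and the subalgebra with a component in the subalgebra
comes from `X_1`, which rotates each pair `oddVec`, `evenVec`. -/
theorem lie_adaptedFamily {lam : Fin K → ℝ} (hlam : ∀ i, 0 < lam i)
    (hsum : ∀ i, ∑ j ∈ Finset.range (K + 1),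
      PowerSeries.coeff (K - j) C * geomCoeff C (-(lam i) ^ 2) j = 0)
    (j : Fin 4) (i : Fin K ⊕ Fin K ⊕ Unit) :
    ⁅adaptedFamily C lam (.inr j), adaptedFamily C lam (.inl i)⁆ =
      if j = 0 then
        Sum.elim
          (fun i => lam i • adaptedFamily C lam (.inl (.inr (.inl i))) -
            geomCoeff C (-(lam i) ^ 2) K • adaptedFamily C lam (.inr 1))
          (Sum.elim
            (fun i => (-lam i) • adaptedFamily C lam (.inl (.inl i)) +
              (lam i)⁻¹ • adaptedFamily C lam (.inr 2))
            fun _ => 0) i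
      else 0 := by
  have hzero : ∀ x : M01 (K + 2), x.coeff 1 = 0 → ∀ i,
      form x (adaptedFamily C lam (.inl i)) = 0 → ⁅x, adaptedFamily C lam (.inl i)⁆ = 0 :=
    fun x hx i h => by
      rw [lie_of_coeff_one_eq_zero hx (coeff_one_adaptedFamily_inl lam i), h, zero_smul]
  have hsmul : ∀ (x y : M01 (K + 2)) (c : ℝ), form x y = 0 → form x (c • y) = 0 :=
    fun x y c h => by rw [form_smul_right, h, mul_zero]
  fin_cases j
  · rcases i with i | i | i
    · simp only [adaptedFamily, Sum.elim_inl, Sum.elim_inr]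
      simp [lie_X_one_oddVec, smul_inv_smul₀ (hlam i).ne']
    · simp only [adaptedFamily, Sum.elim_inl, Sum.elim_inr]
      have : (lam i)⁻¹ * -(lam i) ^ 2 = -lam i := by
        have := (hlam i).ne'
        field_simp
      change ⁅X (K + 2) 1, (lam i)⁻¹ • evenVec K C (-(lam i) ^ 2)⁆ =
        (-lam i) • oddVec K C (-(lam i) ^ 2) + (lam i)⁻¹ • normalVec K C
      rw [lie_smul, lie_X_one_evenVec, smul_add, smul_smul, this]
    · exact lie_X_last _ (by omega)
  · refine (hzero _ (coeff_X_of_ne (by decide)) i ?_).trans (if_neg (by decide)).symm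
    rcases i with i | i | i
    · exact form_X_two_oddVec _
    · exact hsmul _ _ _ (form_X_two_evenVec _)
    · exact form_X_right_eq_zero _ (by omega)
  · refine (hzero _ coeff_one_normalVec i ?_).trans (if_neg (by decide)).symm
    rcases i with i | i | i
    · exact form_normalVec_oddVec _
    · exact hsmul _ _ _ (form_normalVec_evenVec (hsum i))
    · exact form_X_right_eq_zero _ (by omega)
  · exact (hzero _ (coeff_X_of_ne (by omega)) i
      (form_X_left_eq_zero _ (by omega))).trans (if_neg (by decide)).symm

theorem exists_isTotallyGeodesic_codim_four (K : ℕ) :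
    ∃ (I : InnerProductSpace.Core ℝ (M01 (K + 2))) (h : LieSubalgebra ℝ (M01 (K + 2))),
      h ≠ ⊤ ∧ IsTotallyGeodesic I h ∧
        Module.finrank ℝ (M01 (K + 2) ⧸ h.toSubmodule) = 4 := by
  -- any distinct positive numbers serve as frequencies
  let lam : Fin K → ℝ := fun i => (i : ℝ) + 1
  have hlam : ∀ i, 0 < lam i := fun i => by positivity
  have hinj : Function.Injective lam := fun i j hij => by
    simpa [lam, Fin.ext_iff] using hij
  obtain ⟨C, hC, hsum⟩ := exists_sum_coeff_mul_geomCoeff_eq_zero fun i => -(lam i) ^ 2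
  have hli := linearIndependent_adaptedFamily hC hlam hinj
  have hcard : Fintype.card ((Fin K ⊕ Fin K ⊕ Unit) ⊕ Fin 4) =
      Module.finrank ℝ (M01 (K + 2)) := by
    rw [finrank_eq]
    simp
    ring
  let b := basisOfLinearIndependentOfCardEqFinrank hli hcard
  have hb : ⇑b = adaptedFamily C lam := coe_basisOfLinearIndependentOfCardEqFinrank hli hcard
  refine ⟨b.innerCore, geodesicSubalgebra C lam, fun htop => ?_, ?_, ?_⟩
  · have h1 := coeff_one_of_mem_geodesicSubalgebra (C := C) (lam := lam) (x := X (K + 2) 1)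
      (htop ▸ LieSubalgebra.mem_top _)
    rw [coeff_X_self le_rfl (by omega)] at h1
    exact one_ne_zero h1
  · refine isTotallyGeodesic_innerCore b _ (by rw [hb]; rfl) fun j i i' => ?_
    rw [hb, lie_adaptedFamily hlam hsum, lie_adaptedFamily hlam hsum, ← hb]
    split_ifs
    · rcases i with i | i | i <;> rcases i' with i' | i' | i' <;>
        simp [Finsupp.single_apply, eq_comm (a := i')]
      all_goals split_ifs with hii <;> simp [*]
    · simp
  · have h1 := (geodesicSubalgebra C lam).toSubmodule.finrank_quotient_add_finrank
    have h2 : Module.finrank ℝ (geodesicSubalgebra C lam).toSubmodule =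
        Fintype.card (Fin K ⊕ Fin K ⊕ Unit) :=
      finrank_span_eq_card (hli.comp _ Sum.inl_injective)
    rw [h2, finrank_eq] at h1
    simp only [Fintype.card_sum, Fintype.card_fin, Fintype.card_unit] at h1
    omega

end M01

theorem theoremT (k : ℕ) (hk : 3 ≤ k) :
    IsLeast
      {c : ℕ | ∃ (I : InnerProductSpace.Core ℝ (M01 k)) (h : LieSubalgebra ℝ (M01 k)),
        h ≠ ⊤ ∧ IsTotallyGeodesic I h ∧ Module.finrank ℝ (M01 k ⧸ h.toSubmodule) = c}
      4 := by
  refine ⟨?_, ?_⟩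
  · obtain ⟨K, rfl⟩ : ∃ K, k = K + 2 := ⟨k - 2, by omega⟩
    exact M01.exists_isTotallyGeodesic_codim_four K
  · rintro c ⟨I, h, htop, hI, rfl⟩
    exact M01.four_le_codim hk htop hI
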